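/- Let $\Gamma$ be a group acting geometrically (that is, properly and cocompactly by isometries) on a CAT(0) space $X$. Let $\partial X$ be the boundary of $X$, that is, the set of asymptoty classes of geodesic rays in $X$, with the cone topology and the action of $\Gamma$ induced by the action on $X$. For $\gamma\in\Gamma$ of infinite order, $o(\gamma)=\infty$, let $\gamma^\infty\in\partial X$ denote the limit of the sequence $(\gamma^n x_0)_{n\in\mathbb{N}}$ in $X\cup\partial X$, where $x_0\in X$ is any point. (1) If there exists $\delta\in\Gamma$ such that $o(\delta)=\infty$ and the orbit $\Gamma\delta^\infty$ is dense in $\partial X$, then the set $\{\gamma^\infty \mid \gamma\in\Gamma,\ o(\gamma)=\infty\}$ is dense in $\partial X$. (2) Hence, if $\partial X$ is minimal, that is, if every $\Gamma$-orbit in $\partial X$ is dense in $\partial X$, then the set $\{\gamma^\infty \mid \gamma\in\Gamma,\ o(\gamma)=\infty\}$ is dense in $\partial X$. -/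

import Mathlib

open Filter Topology
open scoped NNReal

/-- `c`, restricted to `[0, dist x y]`, is a geodesic from `x` to `y` (parametrised by arc length);
the values of `c` outside this interval are irrelevant. -/
def IsGeodesicFromTo {X : Type*} [MetricSpace X] (c : ℝ → X) (x y : X) : Prop :=
  c 0 = x ∧ c (dist x y) = y ∧
    ∀ s ∈ Set.Icc 0 (dist x y), ∀ t ∈ Set.Icc 0 (dist x y), dist (c s) (c t) = |s - t|

/-- A CAT(0) space: a geodesic metric space in which every geodesic triangle is at least as thin as
its comparison triangle in the Euclidean plane. In a triangle with vertices `p, q, r`, two points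
on different sides lie on two sides that issue from a common vertex, which is called `p` here;
`x'` and `y'` are the comparison points of `c₁ s` and `c₂ t`. -/
structure IsCAT0Space (X : Type*) [MetricSpace X] : Prop where
  exists_geodesic : ∀ x y : X, ∃ c : ℝ → X, IsGeodesicFromTo c x y
  comparison : ∀ (p q r : X) (c₁ c₂ : ℝ → X),
    IsGeodesicFromTo c₁ p q → IsGeodesicFromTo c₂ p r →
    ∀ s ∈ Set.Icc 0 (dist p q), ∀ t ∈ Set.Icc 0 (dist p r),
    ∀ p' q' r' x' y' : EuclideanSpace ℝ (Fin 2),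
      dist p' q' = dist p q → dist p' r' = dist p r → dist q' r' = dist q r →
      dist p' x' = s → dist x' q' = dist p q - s →
      dist p' y' = t → dist y' r' = dist p r - t →
      dist (c₁ s) (c₂ t) ≤ dist x' y'

/-- An isometric action is geometric if it is proper (every point has a ball around it that meets
only finitely many of its translates) and cocompact. -/
structure IsGeometricAction (Γ X : Type*) [Group Γ] [MetricSpace X] [MulAction Γ X]
    [IsIsometricSMul Γ X] : Prop where
  proper : ∀ x : X, ∃ r : ℝ, 0 < r ∧
    {γ : Γ | (((γ • ·) '' Metric.ball x r) ∩ Metric.ball x r).Nonempty}.Finite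
  cocompact : ∃ K : Set X, IsCompact K ∧ ⋃ γ : Γ, (γ • ·) '' K = Set.univ

/-- A geodesic ray in `X`. -/
structure GeodesicRay (X : Type*) [MetricSpace X] where
  toFun : ℝ≥0 → X
  isometry : Isometry toFun

/-- Two geodesic rays are asymptotic if they stay at bounded distance from each other. -/
def GeodesicRay.Asymptotic {X : Type*} [MetricSpace X] (c c' : GeodesicRay X) : Prop :=
  ∃ K : ℝ, ∀ t : ℝ≥0, dist (c.toFun t) (c'.toFun t) ≤ K

instance GeodesicRay.setoid (X : Type*) [MetricSpace X] : Setoid (GeodesicRay X) where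
  r := GeodesicRay.Asymptotic
  iseqv :=
    { refl := fun c => ⟨0, fun t => by simp⟩
      symm := fun ⟨K, hK⟩ => ⟨K, fun t => by rw [dist_comm]; exact hK t⟩
      trans := fun ⟨K, hK⟩ ⟨L, hL⟩ =>
        ⟨K + L, fun t => (dist_triangle _ _ _).trans (add_le_add (hK t) (hL t))⟩ }

/-- The boundary `∂X`: the set of asymptoty classes of geodesic rays. -/
def CAT0Boundary (X : Type*) [MetricSpace X] : Type _ :=
  Quotient (GeodesicRay.setoid X)

/-- The point at infinity of a geodesic ray. -/
def GeodesicRay.endpoint {X : Type*} [MetricSpace X] (c : GeodesicRay X) : CAT0Boundary X :=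
  Quotient.mk (GeodesicRay.setoid X) c

/-- The translate of a geodesic ray by an isometry of the group. -/
def GeodesicRay.translate {Γ X : Type*} [Group Γ] [MetricSpace X] [MulAction Γ X]
    [IsIsometricSMul Γ X] (γ : Γ) (c : GeodesicRay X) : GeodesicRay X where
  toFun t := γ • c.toFun t
  isometry := (isometry_smul X γ).comp c.isometry

/-- The induced action on the boundary, `γ • [c] = [γ • c]`. -/
instance CAT0Boundary.instMulAction {Γ X : Type*} [Group Γ] [MetricSpace X] [MulAction Γ X]
    [IsIsometricSMul Γ X] : MulAction Γ (CAT0Boundary X) where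
  smul γ := Quotient.map (GeodesicRay.translate γ) fun _ _ ⟨K, hK⟩ =>
    ⟨K, fun t => (dist_smul γ _ _).trans_le (hK t)⟩
  one_smul ξ := by
    induction ξ using Quotient.inductionOn with
    | h c =>
      have h : GeodesicRay.translate (1 : Γ) c = c := by simp [GeodesicRay.translate]
      exact congrArg GeodesicRay.endpoint h
  mul_smul γ₁ γ₂ ξ := by
    induction ξ using Quotient.inductionOn with
    | h c =>
      have h : GeodesicRay.translate (γ₁ * γ₂) c =
          GeodesicRay.translate γ₁ (GeodesicRay.translate γ₂ c) := by
        simp [GeodesicRay.translate, mul_smul]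
      exact congrArg GeodesicRay.endpoint h

/-- The bordification `X ∪ ∂X`. -/
inductive Bordification (X : Type*) [MetricSpace X]
  | pt (x : X) : Bordification X
  | bd (ξ : CAT0Boundary X) : Bordification X

/-- The basic cone neighbourhood `U(c, r, ε)` of the endpoint of the ray `c`: the points `x` of `X`
at distance more than `r` from `c 0`, and the points `ξ` of `∂X`, for which the geodesic from `c 0`
to `x`, resp. the ray from `c 0` in the class `ξ`, is at time `r` at distance less than `ε`
from `c r`. -/
inductive GeodesicRay.ConeNhd {X : Type*} [MetricSpace X] (c : GeodesicRay X) (r : ℝ≥0) (ε : ℝ) :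
    Bordification X → Prop
  | pt (x : X) (g : ℝ → X) (hg : IsGeodesicFromTo g (c.toFun 0) x)
      (hr : (r : ℝ) < dist (c.toFun 0) x) (hε : dist (g r) (c.toFun r) < ε) :
      GeodesicRay.ConeNhd c r ε (Bordification.pt x)
  | bd (c' : GeodesicRay X) (h₀ : c'.toFun 0 = c.toFun 0)
      (hε : dist (c'.toFun r) (c.toFun r) < ε) :
      GeodesicRay.ConeNhd c r ε (Bordification.bd c'.endpoint)

/-- The cone topology on `X ∪ ∂X`, generated by the open balls of `X` and the cone neighbourhoods
`U(c, r, ε)`. Rays `c` with every initial point are allowed: the topology obtained from the rays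
that issue from one base point does not depend on the base point. -/
instance Bordification.coneTopology (X : Type*) [MetricSpace X] :
    TopologicalSpace (Bordification X) :=
  TopologicalSpace.generateFrom
    ({U | ∃ (x : X) (ε : ℝ), 0 < ε ∧ U = Bordification.pt '' Metric.ball x ε} ∪
      {U | ∃ (c : GeodesicRay X) (r : ℝ≥0) (ε : ℝ), 0 < r ∧ 0 < ε ∧
        U = {z | c.ConeNhd r ε z}})

/-- The boundary carries the subspace topology from `X ∪ ∂X`. -/
instance CAT0Boundary.coneTopology (X : Type*) [MetricSpace X] :
    TopologicalSpace (CAT0Boundary X) :=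
  TopologicalSpace.induced Bordification.bd (Bordification.coneTopology X)

/-- `ξ = γ^∞`, that is, for every `x₀` in `X` the sequence `γ ^ n • x₀` converges to `ξ`
in `X ∪ ∂X`. -/
def IsLimitAtInfinity {Γ X : Type*} [Group Γ] [MetricSpace X] [MulAction Γ X]
    (γ : Γ) (ξ : CAT0Boundary X) : Prop :=
  ∀ x₀ : X, Tendsto (fun n : ℕ => Bordification.pt (γ ^ n • x₀)) atTop
    (𝓝 (Bordification.bd ξ))

/-- The set `{γ^∞ | γ ∈ Γ, o(γ) = ∞}` (`orderOf γ = 0` means that `γ` has infinite order). -/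
def infiniteOrderLimits (Γ X : Type*) [Group Γ] [MetricSpace X] [MulAction Γ X] :
    Set (CAT0Boundary X) :=
  {ξ | ∃ γ : Γ, orderOf γ = 0 ∧ IsLimitAtInfinity γ ξ}

/-! ### Geodesics and the CAT(0) inequality in law-of-cosines form. -/

section Geodesics

variable {X : Type*} [MetricSpace X]

/-! Conjugation gives (1): `γ * δ * γ⁻¹` has infinite order and limit `γ • δ^∞`, so the whole orbit
of `δ^∞` consists of such limits.

For (2) it remains to find, when `∂X` is nonempty, an element of infinite order and its limit. If Γ
were torsion, each element would fix a point, and cocompactness would bound the orders: `γ ^ M = 1`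
for a single `M` (`exists_exponent`). But along a geodesic ray compactness yields `h` that almost
translates a piece of the ray forwards (`exists_almost_translation`). The broken geodesic through
`x, h • x, h ^ 2 • x, …` is then so nearly straight that `h ^ M • x ≠ x` (`exists_straightness`), a
contradiction.

An element of infinite order attains a positive minimal displacement, so the orbit of a minimising
point lies on a ray (`exists_ray`). Every other orbit stays at bounded distance from this one and
converges to the endpoint of the ray (`tendsto_endpoint`). -/

theorem IsGeodesicFromTo.dist_left {c : ℝ → X} {x y : X} (h : IsGeodesicFromTo c x y) {t : ℝ}
    (ht : t ∈ Set.Icc 0 (dist x y)) : dist x (c t) = t := by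
  have := h.2.2 0 ⟨le_rfl, dist_nonneg⟩ t ht
  rwa [h.1, zero_sub, abs_neg, abs_of_nonneg ht.1] at this

theorem IsGeodesicFromTo.dist_right {c : ℝ → X} {x y : X} (h : IsGeodesicFromTo c x y) {t : ℝ}
    (ht : t ∈ Set.Icc 0 (dist x y)) : dist (c t) y = dist x y - t := by
  have := h.2.2 t ht (dist x y) ⟨dist_nonneg, le_rfl⟩
  rwa [h.2.1, abs_sub_comm, abs_of_nonneg (sub_nonneg.2 ht.2)] at this

theorem IsGeodesicFromTo.smul {Γ : Type*} [Group Γ] [MulAction Γ X] [IsIsometricSMul Γ X]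
    {c : ℝ → X} {x y : X} (h : IsGeodesicFromTo c x y) (γ : Γ) :
    IsGeodesicFromTo (fun t => γ • c t) (γ • x) (γ • y) := by
  refine ⟨congrArg _ h.1, ?_, ?_⟩
  · rw [dist_smul]; exact congrArg _ h.2.1
  · intro s hs t ht
    rw [dist_smul] at hs ht ⊢
    exact h.2.2 s hs t ht

theorem GeodesicRay.dist_eq (c : GeodesicRay X) (s t : ℝ≥0) :
    dist (c.toFun s) (c.toFun t) = |(s : ℝ) - t| := by
  rw [c.isometry.dist_eq, NNReal.dist_eq]

/-- A segment of a geodesic ray, as a geodesic. -/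
theorem GeodesicRay.isGeodesicFromTo (c : GeodesicRay X) (u v : ℝ≥0) :
    IsGeodesicFromTo (fun t => c.toFun (u + t.toNNReal)) (c.toFun u) (c.toFun (u + v)) := by
  have hd : dist (c.toFun u) (c.toFun (u + v)) = v := by
    rw [c.dist_eq]; push_cast; rw [sub_add_cancel_left, abs_neg, abs_of_nonneg v.coe_nonneg]
  refine ⟨by simp, by simp [hd], ?_⟩
  intro s hs t ht
  rw [c.dist_eq]
  push_cast
  rw [Real.coe_toNNReal s hs.1, Real.coe_toNNReal t ht.1, add_sub_add_left_eq_sub]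

/-- The law of cosines form of the CAT(0) inequality, for two sides issuing from a vertex. -/
theorem IsCAT0Space.dist_sq_le (hX : IsCAT0Space X) {p q r : X} {c₁ c₂ : ℝ → X}
    (h₁ : IsGeodesicFromTo c₁ p q) (h₂ : IsGeodesicFromTo c₂ p r) {s t : ℝ}
    (hs : s ∈ Set.Icc 0 (dist p q)) (ht : t ∈ Set.Icc 0 (dist p r)) :
    dist (c₁ s) (c₂ t) ^ 2 ≤ (s - t) ^ 2 +
      s * t / (dist p q * dist p r) * (dist q r ^ 2 - (dist p q - dist p r) ^ 2) := by
  rcases (dist_nonneg : 0 ≤ dist p q).eq_or_lt with ha | ha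
  · have hs0 : s = 0 := le_antisymm (hs.2.trans_eq ha.symm) hs.1
    subst hs0
    rw [h₁.1, h₂.dist_left ht]; simp
  rcases (dist_nonneg : 0 ≤ dist p r).eq_or_lt with hb | hb
  · have ht0 : t = 0 := le_antisymm (ht.2.trans_eq hb.symm) ht.1
    subst ht0
    rw [h₂.1, dist_comm, h₁.dist_left hs]; simp
  have t1 := dist_triangle_left q r p
  have t2 := dist_triangle p q r
  have t3 := dist_triangle p r q
  rw [dist_comm r q] at t3
  have hcmp := hX.comparison p q r c₁ c₂ h₁ h₂ s hs t ht
  obtain ⟨hs0, hs1⟩ := hs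
  obtain ⟨ht0, ht1⟩ := ht
  have hc : 0 ≤ dist q r := dist_nonneg
  generalize dist p q = a at *
  generalize dist p r = b at *
  generalize dist q r = c at *
  -- `k` and `l` are the cosine and sine of the comparison angle at `p`, which is placed at the
  -- origin with `q` on the first axis.
  obtain ⟨k, hk⟩ : ∃ k : ℝ, k = (a ^ 2 + b ^ 2 - c ^ 2) / (2 * a * b) := ⟨_, rfl⟩
  have hkab : 2 * a * b * k = a ^ 2 + b ^ 2 - c ^ 2 := by rw [hk]; field_simp
  have hab : 0 < 2 * a * b := by positivity
  have hk1 : k ≤ 1 := by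
    rw [hk, div_le_one hab]; nlinarith
  have hk2 : -1 ≤ k := by
    rw [hk, le_div_iff₀ hab]; nlinarith
  have hl : √(1 - k ^ 2) ^ 2 = 1 - k ^ 2 := Real.sq_sqrt (by nlinarith)
  set l := √(1 - k ^ 2)
  have hd : ∀ x y z w : ℝ, dist (!₂[x, y] : EuclideanSpace ℝ (Fin 2)) !₂[z, w] =
      √((x - z) ^ 2 + (y - w) ^ 2) := by
    intro x y z w
    simp [EuclideanSpace.dist_eq, Fin.sum_univ_two, Real.dist_eq, sq_abs]
  have key : ∀ x y z w d : ℝ, 0 ≤ d → (x - z) ^ 2 + (y - w) ^ 2 = d ^ 2 →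
      dist (!₂[x, y] : EuclideanSpace ℝ (Fin 2)) !₂[z, w] = d := by
    intro x y z w d h0 h
    rw [hd, h, Real.sqrt_sq h0]
  have := hcmp !₂[0, 0] !₂[a, 0] !₂[b * k, b * l] !₂[s, 0] !₂[t * k, t * l]
    (key _ _ _ _ _ ha.le (by ring)) (key _ _ _ _ _ hb.le (by linear_combination b ^ 2 * hl))
    (key _ _ _ _ _ hc (by linear_combination b ^ 2 * hl - hkab))
    (key _ _ _ _ _ hs0 (by ring)) (key _ _ _ _ _ (by linarith) (by ring))
    (key _ _ _ _ _ ht0 (by linear_combination t ^ 2 * hl))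
    (key _ _ _ _ _ (by linarith) (by linear_combination (t - b) ^ 2 * hl))
  calc _ ≤ _ := pow_le_pow_left₀ dist_nonneg this 2
    _ = _ := by
      rw [hd, Real.sq_sqrt (by positivity)]
      have hc2 : c ^ 2 = a ^ 2 + b ^ 2 - 2 * a * b * k := by linarith
      have hst : s * t / (a * b) * (2 * a * b * (1 - k)) = 2 * s * t * (1 - k) := by field_simp
      rw [hc2]
      linear_combination t ^ 2 * hl - hst

/-- A point for which the triangle inequality is an equality lies on the geodesic. -/
theorem IsCAT0Space.eq_of_dist_add (hX : IsCAT0Space X) {c : ℝ → X} {x y z : X}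
    (hc : IsGeodesicFromTo c x z) (h : dist x y + dist y z = dist x z) : c (dist x y) = y := by
  obtain ⟨g, hg⟩ := hX.exists_geodesic x y
  have hy : dist x y ≤ dist x z := by linarith [dist_nonneg (x := y) (y := z)]
  have := hX.dist_sq_le hc hg (s := dist x y) (t := dist x y) ⟨dist_nonneg, hy⟩
    ⟨dist_nonneg, le_rfl⟩
  rw [hg.2.1, dist_comm z y, show dist y z = dist x z - dist x y by linarith, sub_self,
    sub_self] at this
  have h0 : dist (c (dist x y)) y ^ 2 ≤ 0 := by simpa using this
  exact dist_eq_zero.1 (pow_eq_zero_iff two_ne_zero |>.1 (le_antisymm h0 (sq_nonneg _)))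

/-- Reversing a geodesic. -/
theorem IsCAT0Space.geodesic_reverse_eq (hX : IsCAT0Space X) {c g : ℝ → X} {x z : X}
    (hc : IsGeodesicFromTo c x z) (hg : IsGeodesicFromTo g z x) {t : ℝ}
    (ht : t ∈ Set.Icc 0 (dist x z)) : g t = c (dist x z - t) := by
  have ht' : dist x z - t ∈ Set.Icc 0 (dist x z) := ⟨by linarith [ht.2], by linarith [ht.1]⟩
  have h1 := hc.dist_left ht'
  have h2 := hc.dist_right ht'
  rw [dist_comm] at h1 h2
  have := hX.eq_of_dist_add hg (y := c (dist x z - t)) (by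
    rw [h1, h2, dist_comm z x]; ring)
  rwa [h2, sub_sub_cancel] at this

/-- The Bruhat–Tits inequality for midpoints. -/
theorem IsCAT0Space.exists_midpoint (hX : IsCAT0Space X) (q r : X) :
    ∃ m : X, ∀ p, dist p m ^ 2 ≤ dist p q ^ 2 / 2 + dist p r ^ 2 / 2 - dist q r ^ 2 / 4 := by
  obtain ⟨c, hc⟩ := hX.exists_geodesic q r
  refine ⟨c (dist q r / 2), fun p => ?_⟩
  obtain ⟨g, hg⟩ := hX.exists_geodesic q p
  have h0 : 0 ≤ dist q r := dist_nonneg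
  have := hX.dist_sq_le hg hc (s := dist q p) (t := dist q r / 2) ⟨dist_nonneg, le_rfl⟩
    ⟨by linarith, by linarith⟩
  rw [hg.2.1, dist_comm q p] at this
  refine this.trans (le_of_eq ?_)
  rcases eq_or_ne (dist p q) 0 with h | h
  · rw [dist_eq_zero] at h; subst h; simp; ring
  rcases eq_or_ne (dist q r) 0 with h' | h'
  · rw [dist_eq_zero] at h'; subst h'; simp
  field_simp
  ring

/-- Geodesics with common origin and nearby endpoints are close, measured from their endpoints. -/
theorem IsCAT0Space.dist_le_of_sub_eq (hX : IsCAT0Space X) {p q r : X} {c₁ c₂ : ℝ → X}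
    (h₁ : IsGeodesicFromTo c₁ p q) (h₂ : IsGeodesicFromTo c₂ p r) {u : ℝ} (hu : 0 ≤ u)
    (hq : u ≤ dist p q) (hr : u ≤ dist p r) :
    dist (c₁ (dist p q - u)) (c₂ (dist p r - u)) ≤ dist q r := by
  have := hX.dist_sq_le h₁ h₂ (s := dist p q - u) (t := dist p r - u)
    ⟨by linarith, by linarith⟩ ⟨by linarith, by linarith⟩
  have h2 : (dist p q - dist p r) ^ 2 ≤ dist q r ^ 2 := by
    rw [sq_le_sq, abs_of_nonneg (dist_nonneg : 0 ≤ dist q r), dist_comm p q, dist_comm p r]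
    exact abs_dist_sub_le q r p
  -- The parameters differ by `dist p q - dist p r`, so the bound is a convex combination of the two
  -- sides of `h2`.
  have h3 : (dist p q - u) * (dist p r - u) / (dist p q * dist p r) ≤ 1 := by
    apply div_le_one_of_le₀ _ (by positivity)
    gcongr <;> linarith
  refine le_of_sq_le_sq ?_ dist_nonneg
  nlinarith [mul_le_mul_of_nonneg_right h3 (sub_nonneg.2 h2)]

/-- Geodesics with common origin and endpoints at bounded distance are close near the origin. -/
theorem IsCAT0Space.dist_sq_le_div (hX : IsCAT0Space X) {p q r : X} {c₁ c₂ : ℝ → X}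
    (h₁ : IsGeodesicFromTo c₁ p q) (h₂ : IsGeodesicFromTo c₂ p r) {u : ℝ} (hu : 0 ≤ u)
    (hq : u ≤ dist p q) (hr : u ≤ dist p r) :
    dist (c₁ u) (c₂ u) ^ 2 ≤ u ^ 2 * dist q r ^ 2 / (dist p q * dist p r) := by
  have := hX.dist_sq_le h₁ h₂ (s := u) (t := u) ⟨hu, hq⟩ ⟨hu, hr⟩
  refine this.trans ?_
  rw [sub_self, zero_pow two_ne_zero, zero_add, ← sq, mul_div_right_comm]
  gcongr
  linarith [sq_nonneg (dist p q - dist p r)]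

end Geodesics

/-! ### Geometric actions: properness, fixed points, bounded exponent. -/

section GeometricActions

variable {Γ X : Type*} [Group Γ] [MetricSpace X] [MulAction Γ X] [IsIsometricSMul Γ X]

/-- Uniform discreteness of the orbits of a geometric action. -/
theorem IsGeometricAction.exists_finite_near (hΓ : IsGeometricAction Γ X) :
    ∃ ρ : ℝ, 0 < ρ ∧ ∀ x y : X, {γ : Γ | dist (γ • x) y < ρ}.Finite := by
  obtain ⟨K, hK, hKu⟩ := hΓ.cocompact
  choose r hr hfin using hΓ.proper
  have hlocal : ∀ x y : X, {γ : Γ | dist (γ • x) y < r y}.Finite := by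
    intro x y
    rcases Set.eq_empty_or_nonempty {γ : Γ | dist (γ • x) y < r y} with h | ⟨γ₀, h₀⟩
    · rw [h]; exact Set.finite_empty
    refine ((hfin y).image (· * γ₀)).subset fun γ hγ => ⟨γ * γ₀⁻¹, ?_, by simp⟩
    exact ⟨γ • x, ⟨γ₀ • x, h₀, by simp [smul_smul]⟩, hγ⟩
  -- A Lebesgue number makes the radius uniform on `K`; translation then makes it uniform on `X`.
  obtain ⟨ρ, hρ, hleb⟩ := lebesgue_number_lemma_of_metric (c := fun y : X => Metric.ball y (r y))
    hK (fun _ => Metric.isOpen_ball)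
    (fun y _ => Set.mem_iUnion.2 ⟨y, Metric.mem_ball_self (hr y)⟩)
  refine ⟨ρ, hρ, fun x y => ?_⟩
  have hy : y ∈ ⋃ γ : Γ, (γ • ·) '' K := hKu ▸ Set.mem_univ y
  obtain ⟨g, k, hk, rfl⟩ := Set.mem_iUnion.1 hy
  obtain ⟨z, hz⟩ := hleb k hk
  refine ((hlocal x z).image (g * ·)).subset fun γ hγ => ⟨g⁻¹ * γ, hz ?_, by simp⟩
  rw [Metric.mem_ball, ← dist_smul g, smul_smul, mul_inv_cancel_left]
  exact hγ

/-- The action is uniformly properly discontinuous on compact sets. -/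
theorem IsGeometricAction.exists_finite_compact (hΓ : IsGeometricAction Γ X) :
    ∃ ρ : ℝ, 0 < ρ ∧ ∀ C D : Set X, IsCompact C → IsCompact D →
      {γ : Γ | ∃ x ∈ C, ∃ y ∈ D, dist (γ • x) y < ρ}.Finite := by
  obtain ⟨ρ, hρ, h⟩ := hΓ.exists_finite_near
  have h3 : 0 < ρ / 3 := by positivity
  refine ⟨ρ / 3, h3, fun C D hC hD => ?_⟩
  obtain ⟨s, -, hs, hCs⟩ := hC.finite_cover_balls h3
  obtain ⟨t, -, ht, hDt⟩ := hD.finite_cover_balls h3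
  refine (hs.biUnion fun x _ => ht.biUnion fun y _ => h x y).subset ?_
  rintro γ ⟨x, hx, y, hy, hxy⟩
  obtain ⟨a, ha, hxa⟩ := Set.mem_iUnion₂.1 (hCs hx)
  obtain ⟨b, hb, hyb⟩ := Set.mem_iUnion₂.1 (hDt hy)
  refine Set.mem_biUnion ha (Set.mem_biUnion hb ?_)
  rw [Metric.mem_ball] at hxa hyb
  have h1 : dist (γ • a) (γ • x) < ρ / 3 := by rwa [dist_smul, dist_comm]
  have h2 := dist_triangle4 (γ • a) (γ • x) y b
  simp only [Set.mem_ofPred_eq]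
  linarith

/-- Finitely many translates of `K` cover the ρ-neighbourhood of a compact set, and geodesics
exhaust any ball in steps shorter than `ρ`. -/
theorem IsGeometricAction.properSpace (hX : IsCAT0Space X) (hΓ : IsGeometricAction Γ X) :
    ProperSpace X := by
  obtain ⟨K, hK, hKu⟩ := hΓ.cocompact
  obtain ⟨ρ, hρ, hfin⟩ := hΓ.exists_finite_compact
  have thick : ∀ C : Set X, IsCompact C →
      ∃ D, IsCompact D ∧ ∀ x ∈ C, ∀ y, dist x y < ρ → y ∈ D := by
    intro C hC
    refine ⟨⋃ γ ∈ {γ : Γ | ∃ x ∈ K, ∃ y ∈ C, dist (γ • x) y < ρ}, (γ • ·) '' K,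
      (hfin K C hK hC).isCompact_biUnion fun γ _ => hK.image (isometry_smul X γ).continuous, ?_⟩
    intro x hx y hxy
    have hy : y ∈ ⋃ γ : Γ, (γ • ·) '' K := hKu ▸ Set.mem_univ y
    obtain ⟨g, k, hk, rfl⟩ := Set.mem_iUnion.1 hy
    exact Set.mem_biUnion (x := g) ⟨k, hk, x, hx, by rwa [dist_comm]⟩ ⟨k, hk, rfl⟩
  have balls : ∀ (x : X) (n : ℕ), ∃ D, IsCompact D ∧ Metric.ball x (n * ρ) ⊆ D := by
    intro x n
    induction n with
    | zero => exact ⟨∅, isCompact_empty, by simp⟩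
    | succ n ih =>
      obtain ⟨C, hC, hsub⟩ := ih
      -- The ball of radius `0` is empty, so the centre is added to start the induction.
      obtain ⟨D, hD, hCD⟩ := thick (insert x C) (hC.insert x)
      refine ⟨D, hD, fun y hy => ?_⟩
      rw [Metric.mem_ball, dist_comm] at hy
      push_cast at hy
      rcases Nat.eq_zero_or_pos n with rfl | hn
      · exact hCD x (Set.mem_insert _ _) y (by simpa using hy)
      obtain ⟨c, hc⟩ := hX.exists_geodesic x y
      have hn' : (0 : ℝ) < n := by exact_mod_cast hn
      have ht : dist x y * (n / (n + 1)) ∈ Set.Icc 0 (dist x y) :=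
        ⟨by positivity, mul_le_of_le_one_right dist_nonneg
          (div_le_one_of_le₀ (by linarith) (by positivity))⟩
      have hlt : dist x y / (n + 1) < ρ := by rw [div_lt_iff₀ (by positivity)]; linarith
      refine hCD (c (dist x y * (n / (n + 1)))) (Set.mem_insert_of_mem _ (hsub ?_)) y ?_
      · rw [Metric.mem_ball, dist_comm, hc.dist_left ht]
        calc dist x y * (n / (n + 1)) = n * (dist x y / (n + 1)) := by ring
          _ < n * ρ := by gcongr
      · rw [hc.dist_right ht]
        calc dist x y - dist x y * (n / (n + 1)) = dist x y / (n + 1) := by field_simp; ring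
          _ < ρ := hlt
  refine ⟨fun x r => ?_⟩
  obtain ⟨n, hn⟩ := exists_nat_gt (r / ρ)
  obtain ⟨D, hD, hsub⟩ := balls x n
  refine hD.of_isClosed_subset Metric.isClosed_closedBall
    ((Metric.closedBall_subset_ball ?_).trans hsub)
  rwa [div_lt_iff₀ hρ] at hn

theorem IsGeometricAction.finite_dist_le (hX : IsCAT0Space X) (hΓ : IsGeometricAction Γ X)
    {C : Set X} (hC : IsCompact C) (R : ℝ) :
    {γ : Γ | ∃ x ∈ C, ∃ y ∈ C, dist (γ • x) y ≤ R}.Finite := by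
  have := IsGeometricAction.properSpace hX hΓ
  obtain ⟨ρ, hρ, hfin⟩ := hΓ.exists_finite_compact
  refine (hfin C _ hC (hC.cthickening (r := R))).subset ?_
  rintro γ ⟨x, hx, y, hy, h⟩
  exact ⟨x, hx, γ • x, Metric.mem_cthickening_of_dist_le _ _ _ _ hy h, by simpa using hρ⟩

/-- Elements of finite order have fixed points. -/
theorem exists_smul_eq_of_isOfFinOrder (hX : IsCAT0Space X) [ProperSpace X] [Nonempty X] {γ : Γ}
    (hγ : IsOfFinOrder γ) : ∃ x : X, γ • x = x := by
  obtain ⟨x₀⟩ := ‹Nonempty X›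
  set n := orderOf γ with hn
  have hn0 : 0 < n := hγ.orderOf_pos
  -- `f` is proper and γ-invariant. The midpoint of two distinct minimisers would have a smaller
  -- value, so `γ` fixes a minimiser.
  set f : X → ℝ := fun z => ∑ i ∈ Finset.range n, dist z (γ ^ i • x₀) ^ 2 with hf
  have hcont : Continuous f := by fun_prop
  have hge : ∀ z, dist z x₀ ^ 2 ≤ f z := by
    intro z
    have := Finset.single_le_sum (f := fun i => dist z (γ ^ i • x₀) ^ 2)
      (fun i _ => sq_nonneg _) (Finset.mem_range.2 hn0)
    simpa using this
  have hlim : Tendsto f (cocompact X) atTop :=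
    tendsto_atTop_mono hge ((tendsto_pow_atTop two_ne_zero).comp
      (tendsto_dist_right_cocompact_atTop x₀))
  obtain ⟨z, hz⟩ := hcont.exists_forall_le hlim
  have hinv : f (γ • z) = f z := by
    have h1 : ∀ i, dist (γ • z) (γ ^ (i + 1) • x₀) = dist z (γ ^ i • x₀) := by
      intro i
      rw [pow_succ', mul_smul, dist_smul]
    have h2 := Finset.sum_range_succ (fun i => dist (γ • z) (γ ^ i • x₀) ^ 2) n
    rw [Finset.sum_range_succ'] at h2
    simp only [h1] at h2
    rw [hn, pow_orderOf_eq_one, ← hn, pow_zero] at h2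
    exact (add_right_cancel h2).symm
  refine ⟨z, ?_⟩
  obtain ⟨m, hm⟩ := hX.exists_midpoint z (γ • z)
  have hsum : f m ≤ f z / 2 + f (γ • z) / 2 - n * (dist z (γ • z) ^ 2 / 4) := by
    have := Finset.sum_le_sum (s := Finset.range n) fun i _ => hm (γ ^ i • x₀)
    rw [Finset.sum_sub_distrib, Finset.sum_add_distrib, ← Finset.sum_div, ← Finset.sum_div,
      Finset.sum_const, Finset.card_range, nsmul_eq_mul] at this
    simpa only [hf, dist_comm _ (γ ^ _ • x₀)] using this
  rw [hinv] at hsum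
  have h0 : (n : ℝ) * (dist z (γ • z) ^ 2 / 4) ≤ 0 := by linarith [hz m]
  have hn' : (0 : ℝ) < n := by exact_mod_cast hn0
  have h3 : dist z (γ • z) ^ 2 ≤ 0 := by nlinarith
  exact (dist_eq_zero.1 (pow_eq_zero_iff two_ne_zero |>.1 (le_antisymm h3 (sq_nonneg _)))).symm

/-- A torsion group acting geometrically has finite exponent. -/
theorem IsGeometricAction.exists_exponent (hX : IsCAT0Space X) (hΓ : IsGeometricAction Γ X)
    [Nonempty X] (htor : ∀ γ : Γ, IsOfFinOrder γ) : ∃ M : ℕ, 0 < M ∧ ∀ γ : Γ, γ ^ M = 1 := by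
  have := IsGeometricAction.properSpace hX hΓ
  obtain ⟨K, hK, hKu⟩ := hΓ.cocompact
  have hfin := IsGeometricAction.finite_dist_le hX hΓ hK 0
  -- Every element is conjugate to one that fixes a point of `K`, hence to one of the finitely many
  -- `γ` for which `γK` meets `K`.
  refine ⟨∏ γ ∈ hfin.toFinset, orderOf γ, Finset.prod_pos fun γ _ => (htor γ).orderOf_pos,
    fun γ => ?_⟩
  obtain ⟨x, hx⟩ := exists_smul_eq_of_isOfFinOrder hX (htor γ)
  have hxm : x ∈ ⋃ γ : Γ, (γ • ·) '' K := hKu ▸ Set.mem_univ x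
  obtain ⟨g, k, hk, rfl⟩ := Set.mem_iUnion.1 hxm
  have hfix : (g⁻¹ * γ * g) • k = k := by
    rw [mul_smul, mul_smul, inv_smul_eq_iff]; exact hx
  have hmem : g⁻¹ * γ * g ∈ hfin.toFinset :=
    hfin.mem_toFinset.2 ⟨k, hk, k, hk, by rw [hfix, dist_self]⟩
  have h1 := orderOf_dvd_iff_pow_eq_one.1 (Finset.dvd_prod_of_mem orderOf hmem)
  have h2 : γ = g * (g⁻¹ * γ * g) * g⁻¹ := by group
  rw [h2, conj_pow, h1, mul_one, mul_inv_cancel]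

end GeometricActions

/-! ### Existence of an element of infinite order. -/

section Torsion

variable {Γ X : Type*} [Group Γ] [MetricSpace X] [MulAction Γ X] [IsIsometricSMul Γ X]

/-- In a triangle with an almost straight angle at `q`, the angle at `r` is small. -/
theorem IsCAT0Space.dist_sq_le_of_almost_straight (hX : IsCAT0Space X) {p q r : X}
    {g σ g' : ℝ → X} (hg : IsGeodesicFromTo g q p) (hσ : IsGeodesicFromTo σ q r)
    (hg' : IsGeodesicFromTo g' r p) (hp : 1 ≤ dist q p) (hr : 1 ≤ dist q r) {η : ℝ}
    (hη0 : 0 ≤ η) (hη : η ≤ 1 / 2) (h : 2 - η ≤ dist (g 1) (σ 1)) :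
    1 ≤ dist r p ∧ dist (g' 1) (σ (dist q r - 1)) ^ 2 ≤ 4 * η := by
  have h1 := hX.dist_sq_le hg hσ (s := 1) (t := 1) ⟨zero_le_one, hp⟩ ⟨zero_le_one, hr⟩
  obtain ⟨τ, hτ⟩ := hX.exists_geodesic r q
  have h2 := hX.geodesic_reverse_eq hσ hτ (t := 1) ⟨zero_le_one, hr⟩
  have h3 : 1 ≤ dist r p → _ := fun h' => hX.dist_sq_le hg' hτ (s := 1) (t := 1) ⟨zero_le_one, h'⟩
    ⟨zero_le_one, by rwa [dist_comm]⟩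
  rw [h2] at h3
  have h4 : (2 - η) ^ 2 ≤ dist (g 1) (σ 1) ^ 2 := pow_le_pow_left₀ (by linarith) h 2
  have htri := dist_triangle_right r p q
  rw [dist_comm p q] at htri
  rw [dist_comm r q, dist_comm p q] at h3
  rw [dist_comm p r] at h1
  rw [dist_comm r q] at htri
  have hC0 : 0 ≤ dist r p := dist_nonneg
  generalize dist q p = A at *
  generalize dist q r = a at *
  generalize dist r p = C at *
  have hAa : 0 < A * a := by positivity
  have h5 : (4 - 4 * η) * (A * a) ≤ C ^ 2 - (A - a) ^ 2 := by
    have : 4 - 4 * η ≤ 1 / (A * a) * (C ^ 2 - (A - a) ^ 2) := by nlinarith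
    rw [one_div, inv_mul_eq_div, le_div_iff₀ hAa] at this
    exact this
  -- As `η ≤ 1 / 2`, the comparison angle at `q` is at least a right angle, so `C` is the longest
  -- side.
  have hAC : A ≤ C := by
    apply le_of_sq_le_sq _ hC0
    nlinarith [mul_nonneg hAa.le (sub_nonneg.2 hη)]
  have hC : 1 ≤ C := hp.trans hAC
  refine ⟨hC, (h3 hC).trans ?_⟩
  have hCa : 0 < C * a := by positivity
  rw [sub_self, mul_one, one_div, inv_mul_eq_div, zero_pow two_ne_zero, zero_add,
    div_le_iff₀ hCa]
  have h6 : (A + a - C) * (A + a + C) ≤ 4 * η * (A * a) := by nlinarith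
  have h7 : 0 ≤ A + a - C := by linarith
  have h8 : (A ^ 2 - (C - a) ^ 2) = (A + a - C) * (A + C - a) := by ring
  rw [h8]
  calc (A + a - C) * (A + C - a) ≤ (A + a - C) * (A + a + C) := by gcongr; linarith
    _ ≤ 4 * η * (A * a) := h6
    _ ≤ 4 * η * (C * a) := by gcongr

/-- The orbit of a point `x` under the powers of `h` does not close up after `k + 1` steps if the
broken geodesic through it is sufficiently straight. -/
theorem IsCAT0Space.exists_straightness (hX : IsCAT0Space X) (k : ℕ) :
    ∀ η : ℝ, 0 < η → ∃ ε : ℝ, 0 < ε ∧ ∀ (x : X) (h : Γ) (σ : ℝ → X),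
      IsGeodesicFromTo σ x (h • x) → 1 ≤ dist x (h • x) →
      2 - ε ≤ dist (σ (dist x (h • x) - 1)) (h • σ 1) →
      1 ≤ dist (h ^ (k + 1) • x) x ∧ ∀ g, IsGeodesicFromTo g (h ^ (k + 1) • x) x →
        2 - η ≤ dist (g 1) (h ^ (k + 1) • σ 1) := by
  -- The angle at the current endpoint, between the geodesic back to `x` and the next translate of
  -- `σ`, stays almost straight. `ε` may shrink with `k`, since only one exponent is needed.
  induction k with
  | zero =>
    intro η hη
    refine ⟨η, hη, fun x h σ hσ h1 hb => ?_⟩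
    rw [zero_add, pow_one]
    refine ⟨by rwa [dist_comm], fun g hg => ?_⟩
    rwa [hX.geodesic_reverse_eq hσ hg ⟨zero_le_one, h1⟩]
  | succ k ih =>
    intro η hη
    -- Chosen so that `2 * √η' ≤ η / 2`; the other half of `η` pays for the bend of the broken
    -- geodesic.
    set η' := min (1 / 2) ((η / 4) ^ 2)
    have hη' : 0 < η' := by positivity
    obtain ⟨ε, hε, H⟩ := ih η' hη'
    refine ⟨min ε (η / 2), by positivity, fun x h σ hσ h1 hb => ?_⟩
    obtain ⟨hk1, hk2⟩ := H x h σ hσ h1 (by linarith [min_le_left ε (η / 2)])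
    obtain ⟨g₀, hg₀⟩ := hX.exists_geodesic (h ^ (k + 1) • x) x
    have hσk := hσ.smul (h ^ (k + 1))
    rw [smul_smul, ← pow_succ] at hσk
    have hd : dist (h ^ (k + 1) • x) (h ^ (k + 1 + 1) • x) = dist x (h • x) := by
      rw [pow_succ h (k + 1), mul_smul, dist_smul]
    have key := fun g hg => hX.dist_sq_le_of_almost_straight hg₀ hσk (g' := g) hg hk1
      (by rwa [hd]) hη'.le (min_le_left _ _) (hk2 g₀ hg₀)
    obtain ⟨g₁, hg₁⟩ := hX.exists_geodesic (h ^ (k + 1 + 1) • x) x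
    refine ⟨(key g₁ hg₁).1, fun g hg => ?_⟩
    have h2 := (key g hg).2
    rw [hd] at h2
    have h3 : dist (g 1) (h ^ (k + 1) • σ (dist x (h • x) - 1)) ≤ η / 2 := by
      refine le_of_sq_le_sq (h2.trans ?_) (by positivity)
      have : η' ≤ (η / 4) ^ 2 := min_le_right _ _
      linarith
    have h4 : dist (h ^ (k + 1) • σ (dist x (h • x) - 1)) (h ^ (k + 1 + 1) • σ 1) =
        dist (σ (dist x (h • x) - 1)) (h • σ 1) := by
      rw [pow_succ h (k + 1), mul_smul, dist_smul]
    have h5 := dist_triangle_left (h ^ (k + 1) • σ (dist x (h • x) - 1))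
      (h ^ (k + 1 + 1) • σ 1) (g 1)
    linarith [min_le_right ε (η / 2)]

/-- Along a geodesic ray, some group element almost translates a segment of length two. -/
theorem IsGeometricAction.exists_almost_translation (hX : IsCAT0Space X)
    (hΓ : IsGeometricAction Γ X) (c : GeodesicRay X) {ε : ℝ} (hε : 0 < ε) :
    ∃ (h : Γ) (u v : ℝ≥0), u + 2 ≤ v ∧ dist (h • c.toFun u) (c.toFun v) < ε ∧
      dist (h • c.toFun (u + 1)) (c.toFun (v + 1)) < ε ∧
      dist (h • c.toFun (u + 2)) (c.toFun (v + 2)) < ε := by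
  have := IsGeometricAction.properSpace hX hΓ
  obtain ⟨K, hK, hKu⟩ := hΓ.cocompact
  have hg : ∀ n : ℕ, ∃ g : Γ, g • c.toFun (2 * n) ∈ K := by
    intro n
    have hx : c.toFun (2 * n) ∈ ⋃ γ : Γ, (γ • ·) '' K := hKu ▸ Set.mem_univ _
    obtain ⟨g, k, hk, hgk⟩ := Set.mem_iUnion.1 hx
    exact ⟨g⁻¹, by rw [← hgk, inv_smul_smul]; exact hk⟩
  choose g hg using hg
  have hK' : IsCompact (Metric.cthickening 2 K) := hK.cthickening
  -- Pulled back near `K`, the triples have a convergent subsequence; two close terms differ by the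
  -- required `h`. Sampling at even times ensures `u + 2 ≤ v`.
  set F : ℕ → X × X × X := fun n =>
    (g n • c.toFun (2 * n), g n • c.toFun (2 * n + 1), g n • c.toFun (2 * n + 2))
  have hF : ∀ n, F n ∈ K ×ˢ Metric.cthickening 2 K ×ˢ Metric.cthickening 2 K := by
    intro n
    refine ⟨hg n, ?_, ?_⟩ <;>
    · refine Metric.mem_cthickening_of_dist_le _ _ _ _ (hg n) ?_
      rw [dist_smul, c.dist_eq]
      push_cast
      rw [add_sub_cancel_left]
      norm_num
  obtain ⟨a, -, φ, hφ, hlim⟩ := (hK.prod (hK'.prod hK')).tendsto_subseq hF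
  obtain ⟨N, hN⟩ := Metric.cauchySeq_iff.1 hlim.cauchySeq ε hε
  have hd := hN N le_rfl (N + 1) N.le_succ
  have hlt : φ N < φ (N + 1) := hφ N.lt_succ_self
  simp only [Function.comp, F, Prod.dist_eq, max_lt_iff] at hd
  have hmove : ∀ s t : ℝ≥0, dist (((g (φ (N + 1)))⁻¹ * g (φ N)) • c.toFun s) (c.toFun t) =
      dist (g (φ N) • c.toFun s) (g (φ (N + 1)) • c.toFun t) := by
    intro s t
    rw [← dist_smul (g (φ (N + 1))), smul_smul, mul_inv_cancel_left]
  refine ⟨(g (φ (N + 1)))⁻¹ * g (φ N), 2 * φ N, 2 * φ (N + 1), ?_, ?_, ?_, ?_⟩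
  · exact_mod_cast (by omega : 2 * φ N + 2 ≤ 2 * φ (N + 1))
  all_goals rw [hmove]
  exacts [hd.1, hd.2.1, hd.2.2]

/-- A group acting geometrically on a CAT(0) space that contains a geodesic ray has an element of
infinite order. -/
theorem IsGeometricAction.exists_orderOf_eq_zero (hX : IsCAT0Space X)
    (hΓ : IsGeometricAction Γ X) (c : GeodesicRay X) : ∃ δ : Γ, orderOf δ = 0 := by
  by_contra! hne
  have : Nonempty X := ⟨c.toFun 0⟩
  obtain ⟨M, hM, hpow⟩ := IsGeometricAction.exists_exponent hX hΓ
    (fun γ => orderOf_pos_iff.1 (Nat.pos_of_ne_zero (hne γ)))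
  obtain ⟨k, rfl⟩ := Nat.exists_eq_succ_of_ne_zero hM.ne'
  obtain ⟨ε, hε, H⟩ := hX.exists_straightness (Γ := Γ) k 1 one_pos
  -- Three errors add up in `hstraight`; the bound by `1` keeps `dist x (h • x)` at least `1`.
  set ε' := min (ε / 3) 1
  have hε' : 0 < ε' := by positivity
  obtain ⟨h, u, v, huv, h0, h1, h2⟩ := hΓ.exists_almost_translation hX c hε'
  have he3 : ε' ≤ ε / 3 := min_le_left _ _
  have he1 : ε' ≤ 1 := min_le_right _ _
  set x := c.toFun (u + 1)
  obtain ⟨w, rfl⟩ := exists_add_of_le huv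
  have hc := c.isGeodesicFromTo (u + 1) (2 + w)
  have hadd : u + 1 + (2 + w) = u + 2 + w + 1 := by ring
  rw [hadd] at hc
  obtain ⟨σ, hσ⟩ := hX.exists_geodesic x (h • x)
  have hb : dist x (c.toFun (u + 2 + w + 1)) = 2 + w := by
    rw [c.dist_eq, abs_sub_comm]
    push_cast
    rw [abs_of_nonneg] <;> [ring; (ring_nf; positivity)]
  have hw : (0 : ℝ) ≤ w := w.coe_nonneg
  have htri := dist_triangle x (h • x) (c.toFun (u + 2 + w + 1))
  have ha : 1 ≤ dist x (h • x) := by linarith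
  have hplus : dist (σ 1) (c.toFun (u + 2)) ≤ ε' := by
    have := hX.dist_sq_le_div hσ hc zero_le_one ha (by linarith)
    rw [Real.toNNReal_one, add_assoc u, one_add_one_eq_two] at this
    refine le_of_sq_le_sq (this.trans ?_) hε'.le
    rw [one_pow, one_mul]
    refine (div_le_self (sq_nonneg _) ?_).trans (pow_le_pow_left₀ dist_nonneg h1.le 2)
    rw [hb]; nlinarith
  have hminus : dist (σ (dist x (h • x) - 1)) (c.toFun (u + 2 + w)) ≤ ε' := by
    have := hX.dist_le_of_sub_eq hσ hc zero_le_one ha (by linarith)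
    rw [hb, show (2 + (w : ℝ) - 1) = ((1 + w : ℝ≥0) : ℝ) by push_cast; ring,
      Real.toNNReal_coe, show u + 1 + (1 + w) = u + 2 + w by ring] at this
    exact this.trans h1.le
  have hstraight : 2 - ε ≤ dist (σ (dist x (h • x) - 1)) (h • σ 1) := by
    have e1 : dist (c.toFun (u + 2 + w)) (c.toFun (u + 2 + w + 2)) = 2 := by
      rw [c.dist_eq]; push_cast; rw [sub_add_cancel_left]; norm_num
    have e2 := dist_triangle4 (c.toFun (u + 2 + w)) (σ (dist x (h • x) - 1)) (h • σ 1)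
      (c.toFun (u + 2 + w + 2))
    have e3 := dist_triangle (h • σ 1) (h • c.toFun (u + 2)) (c.toFun (u + 2 + w + 2))
    rw [dist_smul] at e3
    rw [dist_comm] at hminus
    linarith
  have := (H x h σ hσ ha hstraight).1
  rw [hpow, one_smul, dist_self] at this
  linarith

end Torsion

/-! ### Axes and limits of elements of infinite order. -/

section Axes

variable {Γ X : Type*} [Group Γ] [MetricSpace X] [MulAction Γ X] [IsIsometricSMul Γ X]

/-- The displacement function of an element attains its minimum. -/
theorem IsGeometricAction.exists_min_displacement (hX : IsCAT0Space X)
    (hΓ : IsGeometricAction Γ X) [Nonempty X] (δ : Γ) :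
    ∃ x : X, ∀ y : X, dist x (δ • x) ≤ dist y (δ • y) := by
  obtain ⟨K, hK, hKu⟩ := hΓ.cocompact
  have hcover : ∀ y : X, ∃ g : Γ, ∃ k ∈ K, g • k = y := by
    intro y
    have hy : y ∈ ⋃ γ : Γ, (γ • ·) '' K := hKu ▸ Set.mem_univ y
    obtain ⟨g, k, hk, hgk⟩ := Set.mem_iUnion.1 hy
    exact ⟨g, k, hk, hgk⟩
  obtain ⟨x₁⟩ := ‹Nonempty X›
  have hKne : K.Nonempty := by
    obtain ⟨g, k, hk, -⟩ := hcover x₁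
    exact ⟨k, hk⟩
  have hmin : ∀ γ : Γ, ∃ k ∈ K, ∀ y ∈ K, dist k (γ • k) ≤ dist y (γ • y) := by
    intro γ
    have hcont : Continuous fun y : X => dist y (γ • y) :=
      continuous_id.dist (isometry_smul X γ).continuous
    exact hK.exists_isMinOn hKne hcont.continuousOn
  choose m hmK hm using hmin
  have hconj : ∀ (g : Γ) (k : X), dist k ((g⁻¹ * δ * g) • k) = dist (g • k) (δ • g • k) := by
    intro g k
    rw [← dist_smul g k, smul_smul, smul_smul]
    congr 2
    group
  -- The displacement of `δ` at `g • k` is that of a conjugate at `k`, and only these finitely many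
  -- conjugates can compete with `x₁`.
  set S : Set Γ := {γ | ∃ g : Γ, γ = g⁻¹ * δ * g ∧ ∃ k ∈ K, dist k (γ • k) ≤ dist x₁ (δ • x₁)}
  have hS : S.Finite := by
    refine (IsGeometricAction.finite_dist_le hX hΓ hK (dist x₁ (δ • x₁))).subset ?_
    rintro γ ⟨-, -, k, hk, h⟩
    exact ⟨k, hk, k, hk, by rwa [dist_comm]⟩
  have hmem : ∀ (g : Γ), ∀ k ∈ K, dist (g • k) (δ • g • k) ≤ dist x₁ (δ • x₁) →
      g⁻¹ * δ * g ∈ S := fun g k hk h => ⟨g, rfl, k, hk, by rwa [hconj]⟩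
  obtain ⟨g₁, k₁, hk₁, hgk₁⟩ := hcover x₁
  have h₁ : g₁⁻¹ * δ * g₁ ∈ S := hmem g₁ k₁ hk₁ (by rw [hgk₁])
  obtain ⟨γ, ⟨g, rfl, -⟩, hγ⟩ := Set.exists_min_image S (fun γ => dist (m γ) (γ • m γ)) hS ⟨_, h₁⟩
  refine ⟨g • m (g⁻¹ * δ * g), fun y => ?_⟩
  rw [← hconj]
  have hle : ∀ (h : Γ), ∀ k ∈ K, h⁻¹ * δ * h ∈ S →
      dist (m (g⁻¹ * δ * g)) ((g⁻¹ * δ * g) • m (g⁻¹ * δ * g)) ≤ dist (h • k) (δ • h • k) := by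
    intro h k hk hh
    rw [← hconj]
    exact (hγ _ hh).trans (hm _ k hk)
  rcases le_or_gt (dist y (δ • y)) (dist x₁ (δ • x₁)) with hy | hy
  · obtain ⟨h, k, hk, rfl⟩ := hcover y
    exact hle h k hk (hmem h k hk hy)
  · have := hle g₁ k₁ hk₁ h₁
    rw [hgk₁] at this
    exact this.trans hy.le

/-- The displacement of `δ ^ 2` is at least twice the minimal displacement of `δ`. -/
theorem IsCAT0Space.two_mul_le_dist_sq_smul (hX : IsCAT0Space X) {δ : Γ} {τ : ℝ}
    (hτ : ∀ y : X, τ ≤ dist y (δ • y)) (y : X) : 2 * τ ≤ dist y ((δ ^ 2) • y) := by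
  obtain ⟨c, hc⟩ := hX.exists_geodesic (δ • y) y
  obtain ⟨c₂, hc₂⟩ := hX.exists_geodesic y (δ • y)
  have hc' := hc₂.smul δ
  have ha : (0 : ℝ) ≤ dist y (δ • y) := dist_nonneg
  have hd1 : dist (δ • y) y = dist y (δ • y) := dist_comm _ _
  have hd2 : dist (δ • y) (δ • δ • y) = dist y (δ • y) := dist_smul _ _ _
  -- If `m` is the midpoint of `[y, δy]`, then `δm` is that of `[δy, δ²y]`, and `d(m, δm) ≤ d(y,
  -- δ²y) / 2`.
  have h := hX.dist_sq_le hc hc' (s := dist y (δ • y) / 2) (t := dist y (δ • y) / 2)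
    ⟨by linarith, by linarith⟩ ⟨by linarith, by linarith⟩
  have hrev := hX.geodesic_reverse_eq hc hc₂ (t := dist y (δ • y) / 2)
    ⟨by linarith, by linarith⟩
  rw [hd1, sub_half] at hrev
  have h0 := hτ (c₂ (dist y (δ • y) / 2))
  rw [hd1, hd2, sub_self, sub_self] at h
  rw [hrev] at h0 h
  rw [pow_two, mul_smul]
  have hq : dist y (δ • y) / 2 * (dist y (δ • y) / 2) / (dist y (δ • y) * dist y (δ • y)) ≤
      1 / 4 := by
    apply div_le_of_le_mul₀ (by positivity) (by norm_num)
    linarith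
  have h2 : dist (c (dist y (δ • y) / 2)) (δ • c (dist y (δ • y) / 2)) ≤
      dist y (δ • δ • y) / 2 := by
    refine le_of_sq_le_sq ?_ (by positivity)
    nlinarith [sq_nonneg (dist y (δ • δ • y))]
  linarith

/-- A point of minimal displacement lies on an axis. -/
theorem IsCAT0Space.dist_pow_smul (hX : IsCAT0Space X) {δ : Γ} {x : X}
    (hx : ∀ y : X, dist x (δ • x) ≤ dist y (δ • y)) (m n : ℕ) :
    dist (δ ^ m • x) (δ ^ (m + n) • x) = n * dist x (δ • x) := by
  rw [pow_add, mul_smul, dist_smul]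
  have hub : ∀ n : ℕ, dist x (δ ^ n • x) ≤ n * dist x (δ • x) := by
    intro n
    induction n with
    | zero => simp
    | succ n ih =>
      have h := dist_triangle x (δ ^ n • x) (δ ^ (n + 1) • x)
      rw [pow_succ, mul_smul, dist_smul, ← mul_smul, ← pow_succ] at h
      push_cast
      linarith
  have hlb : ∀ (k : ℕ) (y : X), 2 ^ k * dist x (δ • x) ≤ dist y (δ ^ 2 ^ k • y) := by
    intro k
    induction k with
    | zero => simpa using hx
    | succ k ih =>
      intro y
      have := hX.two_mul_le_dist_sq_smul ih y
      rw [← pow_mul, ← pow_succ] at this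
      rw [pow_succ]
      linarith
  refine le_antisymm (hub n) ?_
  -- `n` is completed to the power `2 ^ n`: the last `l` steps cannot make up for a shortfall in the
  -- first `n`.
  obtain ⟨l, hl⟩ := exists_add_of_le (Nat.lt_two_pow_self (n := n)).le
  have h1 := hlb n x
  have h2 := dist_triangle x (δ ^ n • x) (δ ^ 2 ^ n • x)
  rw [hl, pow_add, mul_smul, dist_smul, ← mul_smul, ← pow_add, ← hl] at h2
  have h3 := hub l
  have h4 : (2 : ℝ) ^ n = n + l := by exact_mod_cast hl
  rw [h4] at h1
  linarith

/-- The ray issuing from a point of an axis. -/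
theorem IsCAT0Space.exists_ray (hX : IsCAT0Space X) {δ : Γ} {x : X}
    (hx : ∀ y : X, dist x (δ • x) ≤ dist y (δ • y)) (hpos : 0 < dist x (δ • x)) :
    ∃ c : GeodesicRay X, ∀ n : ℕ, c.toFun (n * nndist x (δ • x)) = δ ^ n • x := by
  have hd : ∀ n : ℕ, dist x (δ ^ n • x) = n * dist x (δ • x) := by
    intro n
    simpa using hX.dist_pow_smul hx 0 n
  choose g hg using fun n : ℕ => hX.exists_geodesic x (δ ^ n • x)
  -- Geodesics are unique and the orbit distances add up, so the segments extend each other and glue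
  -- to a ray.
  have hcoh : ∀ m n : ℕ, m ≤ n → ∀ t ∈ Set.Icc 0 (m * dist x (δ • x)), g n t = g m t := by
    intro m n hmn t ht
    obtain ⟨l, rfl⟩ := exists_add_of_le hmn
    rw [← hd] at ht
    refine (hX.eq_of_dist_add (hg (m + l)) (y := g m t) ?_).symm.trans ?_ |>.symm
    · have h1 := hX.dist_pow_smul hx m l
      have h2 := dist_triangle (g m t) (δ ^ m • x) (δ ^ (m + l) • x)
      have h3 := dist_triangle x (g m t) (δ ^ (m + l) • x)
      rw [(hg m).dist_right ht, h1] at h2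
      rw [(hg m).dist_left ht, hd] at h3 ⊢
      rw [hd] at h2
      push_cast at h3 ⊢
      linarith
    · rw [(hg m).dist_left ht]
  have hbig : ∀ t : ℝ, t ≤ ⌈t / dist x (δ • x)⌉₊ * dist x (δ • x) := fun t => by
    rw [← div_le_iff₀ hpos]; exact Nat.le_ceil _
  have hval : ∀ (n : ℕ) (t : ℝ), 0 ≤ t → t ≤ n * dist x (δ • x) →
      g ⌈t / dist x (δ • x)⌉₊ t = g n t := by
    intro n t h0 hn
    rcases le_total n ⌈t / dist x (δ • x)⌉₊ with h | h
    · exact hcoh _ _ h t ⟨h0, hn⟩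
    · exact (hcoh _ _ h t ⟨h0, hbig t⟩).symm
  refine ⟨⟨fun t => g ⌈(t : ℝ) / dist x (δ • x)⌉₊ t, Isometry.of_dist_eq fun s t => ?_⟩,
    fun n => ?_⟩
  · have hst := hbig (max (s : ℝ) t)
    rw [hval _ s s.coe_nonneg ((le_max_left _ _).trans hst),
      hval _ t t.coe_nonneg ((le_max_right _ _).trans hst), NNReal.dist_eq]
    rw [← hd] at hst
    exact (hg _).2.2 s ⟨s.coe_nonneg, (le_max_left _ _).trans hst⟩ t
      ⟨t.coe_nonneg, (le_max_right _ _).trans hst⟩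
  · change g ⌈((n * nndist x (δ • x) : ℝ≥0) : ℝ) / dist x (δ • x)⌉₊ _ = _
    push_cast
    rw [hval n _ (by positivity) le_rfl, ← hd]
    exact (hg n).2.1

/-- A sequence at bounded distance from a sequence of points of a ray that leaves every bounded set
converges to the endpoint of the ray. -/
theorem IsCAT0Space.tendsto_endpoint (hX : IsCAT0Space X) (c : GeodesicRay X) {z : ℕ → X}
    {a : ℕ → ℝ≥0} (ha : Tendsto a atTop atTop) {C : ℝ} (hC : ∀ n, dist (z n) (c.toFun (a n)) ≤ C) :
    Tendsto (fun n => Bordification.pt (z n)) atTop (𝓝 (Bordification.bd c.endpoint)) := by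
  rw [TopologicalSpace.tendsto_nhds_generateFrom_iff]
  rintro U (⟨x, ε, -, rfl⟩ | ⟨c', r, ε, hr, hε, rfl⟩) hU
  · obtain ⟨y, -, hy⟩ := hU
    cases hy
  -- Membership of the endpoint in the cone neighbourhood itself supplies an asymptotic ray from
  -- `c'.toFun 0`.
  obtain ⟨c'', hcc, h₀, hε'⟩ : ∃ c'' : GeodesicRay X, c''.endpoint = c.endpoint ∧
      c''.toFun 0 = c'.toFun 0 ∧ dist (c''.toFun r) (c'.toFun r) < ε := by
    generalize hξ : c.endpoint = ξ at hU
    cases hU with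
    | bd c'' h₀ hε' => exact ⟨c'', rfl, h₀, hε'⟩
  obtain ⟨B, hB⟩ : c''.Asymptotic c := Quotient.exact hcc
  set D := C + B
  have hD : ∀ n, dist (z n) (c''.toFun (a n)) ≤ D := fun n => by
    have := dist_triangle_right (z n) (c''.toFun (a n)) (c.toFun (a n))
    linarith [hC n, hB (a n)]
  choose g hg using fun n => hX.exists_geodesic (c'.toFun 0) (z n)
  have hseg : ∀ n, IsGeodesicFromTo (fun t => c''.toFun t.toNNReal) (c'.toFun 0)
      (c''.toFun (a n)) := by
    intro n
    have := c''.isGeodesicFromTo 0 (a n)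
    rwa [zero_add, h₀, funext fun t : ℝ => congrArg c''.toFun (zero_add t.toNNReal)] at this
  have hlen : ∀ n, dist (c'.toFun 0) (c''.toFun (a n)) = a n := by
    intro n
    rw [← h₀, c''.dist_eq, NNReal.coe_zero, zero_sub, abs_neg, NNReal.abs_eq]
  have hlow : ∀ n, (a n : ℝ) - D ≤ dist (c'.toFun 0) (z n) := by
    intro n
    have := dist_triangle (c'.toFun 0) (z n) (c''.toFun (a n))
    rw [hlen] at this
    linarith [hD n]
  have ha' : Tendsto (fun n => (a n : ℝ)) atTop atTop := NNReal.tendsto_coe_atTop.2 ha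
  have hz : Tendsto (fun n => dist (c'.toFun 0) (z n)) atTop atTop :=
    tendsto_atTop_mono hlow (tendsto_atTop_add_const_right _ (-D) ha')
  have hlim : Tendsto (fun n => (r : ℝ) ^ 2 * D ^ 2 / (dist (c'.toFun 0) (z n) * a n)) atTop
      (𝓝 0) := tendsto_const_nhds.div_atTop (hz.atTop_mul_atTop₀ ha')
  have hgap : 0 < (ε - dist (c''.toFun r) (c'.toFun r)) ^ 2 := by
    have := sub_pos.2 hε'
    positivity
  filter_upwards [hz.eventually_gt_atTop (r : ℝ), ha'.eventually_ge_atTop (r : ℝ),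
    hlim.eventually_lt_const hgap] with n h1 h2 h3
  refine GeodesicRay.ConeNhd.pt (z n) (g n) (hg n) h1 ?_
  have h4 := hX.dist_sq_le_div (hg n) (hseg n) r.coe_nonneg h1.le (by rwa [hlen])
  rw [hlen, Real.toNNReal_coe] at h4
  have h5 : dist (g n r) (c''.toFun r) < ε - dist (c''.toFun r) (c'.toFun r) := by
    refine lt_of_pow_lt_pow_left₀ 2 (sub_nonneg.2 hε'.le) (h4.trans_lt (lt_of_le_of_lt ?_ h3))
    gcongr
    exact hD n
  linarith [dist_triangle (g n r) (c''.toFun r) (c'.toFun r)]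

/-- Every element of infinite order has a limit at infinity. -/
theorem IsGeometricAction.exists_isLimitAtInfinity (hX : IsCAT0Space X)
    (hΓ : IsGeometricAction Γ X) [Nonempty X] {δ : Γ} (hδ : orderOf δ = 0) :
    ∃ ξ : CAT0Boundary X, IsLimitAtInfinity δ ξ := by
  obtain ⟨x, hx⟩ := IsGeometricAction.exists_min_displacement hX hΓ δ
  have hpos : 0 < dist x (δ • x) := by
    -- Otherwise all powers of `δ` fix `x`, whose stabiliser is finite.
    refine dist_pos.2 fun hfix => ?_
    refine orderOf_eq_zero_iff.1 hδ (isOfFinOrder_iff_pow_eq_one.2 ?_)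
    have hpow : ∀ n : ℕ, δ ^ n • x = x := by
      intro n
      induction n with
      | zero => simp
      | succ n ih => rw [pow_succ, mul_smul, ← hfix, ih]
    have hfin := IsGeometricAction.finite_dist_le hX hΓ (isCompact_singleton (x := x)) 0
    by_contra! hne
    refine Set.infinite_univ (α := ℕ) (Set.Finite.of_finite_image
      (f := fun n : ℕ => δ ^ n) (hfin.subset ?_) fun m _ n _ hmn => ?_)
    · rintro - ⟨n, -, rfl⟩
      exact ⟨x, rfl, x, rfl, by rw [hpow, dist_self]⟩
    · exact injective_pow_iff_not_isOfFinOrder.2 (orderOf_eq_zero_iff.1 hδ) hmn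
  obtain ⟨c, hc⟩ := hX.exists_ray hx hpos
  refine ⟨c.endpoint, fun x₀ => hX.tendsto_endpoint c (a := fun n => n * nndist x (δ • x))
    (C := dist x₀ x) ?_ fun n => ?_⟩
  · exact tendsto_natCast_atTop_atTop.atTop_mul_const (by exact_mod_cast hpos)
  · rw [hc, dist_smul]

end Axes

/-! ### Equivariance of limits under conjugation. -/

section Conjugation

variable {Γ X : Type*} [Group Γ] [MetricSpace X] [MulAction Γ X] [IsIsometricSMul Γ X]

/-- The action on the bordification by a group element. -/
def Bordification.translate (γ : Γ) : Bordification X → Bordification X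
  | .pt x => .pt (γ • x)
  | .bd ξ => .bd (γ • ξ)

theorem GeodesicRay.translate_inv_translate (γ : Γ) (c : GeodesicRay X) :
    (c.translate γ⁻¹).translate γ = c := by
  simp [GeodesicRay.translate]

theorem GeodesicRay.ConeNhd.translate {c : GeodesicRay X} {r : ℝ≥0} {ε : ℝ}
    {z : Bordification X} (h : c.ConeNhd r ε z) (γ : Γ) :
    (c.translate γ).ConeNhd r ε (z.translate γ) := by
  cases h with
  | pt x g hg hr hε =>
    refine .pt _ _ (hg.smul γ) ?_ ?_
    · simpa [GeodesicRay.translate, dist_smul] using hr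
    · simpa [GeodesicRay.translate, dist_smul] using hε
  | bd c' h₀ hε =>
    refine .bd (c'.translate γ) ?_ ?_
    · simp [GeodesicRay.translate, h₀]
    · simpa [GeodesicRay.translate, dist_smul] using hε

theorem Bordification.translate_inv_translate (γ : Γ) (z : Bordification X) :
    (z.translate γ).translate γ⁻¹ = z := by
  cases z <;> simp [Bordification.translate]

/-- The preimage of a generating open set is its translate by `γ⁻¹`, again a generator because rays
from every initial point are allowed. -/
theorem Bordification.continuous_translate (γ : Γ) :
    Continuous (Bordification.translate γ : Bordification X → Bordification X) := by
  refine continuous_generateFrom_iff.2 ?_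
  rintro U (⟨x, ε, hε, rfl⟩ | ⟨c, r, ε, hr, hε, rfl⟩)
  · refine TopologicalSpace.isOpen_generateFrom_of_mem (Or.inl ⟨γ⁻¹ • x, ε, hε, ?_⟩)
    ext z
    constructor
    · rintro ⟨y, hy, hz⟩
      refine ⟨γ⁻¹ • y, ?_, ?_⟩
      · rwa [Metric.mem_ball, dist_smul]
      · rw [← z.translate_inv_translate γ, ← hz]; rfl
    · rintro ⟨y, hy, rfl⟩
      refine ⟨γ • y, ?_, rfl⟩
      rwa [Metric.mem_ball, ← dist_smul γ⁻¹, inv_smul_smul]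
  · refine TopologicalSpace.isOpen_generateFrom_of_mem
      (Or.inr ⟨c.translate γ⁻¹, r, ε, hr, hε, ?_⟩)
    ext z
    constructor
    · intro h
      have := GeodesicRay.ConeNhd.translate h γ⁻¹
      rwa [z.translate_inv_translate] at this
    · intro h
      have := GeodesicRay.ConeNhd.translate h γ
      rwa [c.translate_inv_translate] at this

/-- The orbit of `x₀` under the conjugate is the γ-translate of the δ-orbit of `γ⁻¹ • x₀`. -/
theorem IsLimitAtInfinity.conj {δ : Γ} {ξ : CAT0Boundary X} (h : IsLimitAtInfinity δ ξ) (γ : Γ) :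
    IsLimitAtInfinity (γ * δ * γ⁻¹) (γ • ξ) := by
  intro x₀
  have := ((Bordification.continuous_translate γ).tendsto _).comp (h (γ⁻¹ • x₀))
  refine this.congr fun n => ?_
  simp [Bordification.translate, conj_pow, mul_smul]

theorem orbit_subset_infiniteOrderLimits {δ : Γ} (hδ : orderOf δ = 0) {ξ : CAT0Boundary X}
    (h : IsLimitAtInfinity δ ξ) : MulAction.orbit Γ ξ ⊆ infiniteOrderLimits Γ X := by
  rintro - ⟨γ, rfl⟩
  refine ⟨γ * δ * γ⁻¹, ?_, h.conj γ⟩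
  rw [← hδ, ← MulAut.conj_apply]
  exact orderOf_injective (MulAut.conj γ).toMonoidHom (MulAut.conj γ).injective δ

end Conjugation

theorem mainTheorem7 {Γ X : Type*} [Group Γ] [MetricSpace X] [MulAction Γ X]
    [IsIsometricSMul Γ X] (hX : IsCAT0Space X) (hΓ : IsGeometricAction Γ X) :
    ((∃ δ : Γ, orderOf δ = 0 ∧ ∃ ξ : CAT0Boundary X,
        IsLimitAtInfinity δ ξ ∧ Dense (MulAction.orbit Γ ξ)) →
      Dense (infiniteOrderLimits Γ X)) ∧
    (MulAction.IsMinimal Γ (CAT0Boundary X) → Dense (infiniteOrderLimits Γ X)) := by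
  have dense_of_dense_orbit : (∃ δ : Γ, orderOf δ = 0 ∧ ∃ ξ : CAT0Boundary X,
      IsLimitAtInfinity δ ξ ∧ Dense (MulAction.orbit Γ ξ)) → Dense (infiniteOrderLimits Γ X) := by
    rintro ⟨δ, hδ, ξ, hξ, hdense⟩
    exact hdense.mono (orbit_subset_infiniteOrderLimits hδ hξ)
  refine ⟨dense_of_dense_orbit, fun hmin => ?_⟩
  -- With empty boundary there need be no element of infinite order, but density is vacuous.
  rcases isEmpty_or_nonempty (CAT0Boundary X) with hempty | ⟨⟨η⟩⟩
  · exact fun ξ => hempty.elim ξ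
  obtain ⟨c, -⟩ := Quotient.exists_rep η
  have : Nonempty X := ⟨c.toFun 0⟩
  obtain ⟨δ, hδ⟩ := hΓ.exists_orderOf_eq_zero hX c
  obtain ⟨ξ, hξ⟩ := hΓ.exists_isLimitAtInfinity hX hδ
  exact dense_of_dense_orbit ⟨δ, hδ, ξ, hξ, hmin.dense_orbit ξ⟩
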